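/- For a compact set $K\subset\mathbb{C}$ let $d=\max_{z,z'\in K}|z-z'|$ be its diameter and $w=\min_{\gamma\in[-\pi,\pi]}\max_{z,z'\in K}\bigl(\Re(ze^{i\gamma})-\Re(z'e^{i\gamma})\bigr)$ its width. Suppose that $K$ is compact and convex with $w>0$, and let $\ell$ be arc length on the boundary $\partial K$. For a polynomial $p$ put $\|p\|_q=\bigl(\int_{\partial K}|p|^q\,d\ell\bigr)^{1/q}$ for $0<q<\infty$ and $\|p\|_\infty=\max_{\partial K}|p|$. For $n\in\{0,1,2,\dots\}$ let $\mathcal{P}_n(K)$ be the set of complex polynomials of degree exactly $n$ all of whose zeros lie in $K$, and let $$M_{n,q}(K)=\inf\left\{\frac{\|p'\|_q}{\|p\|_q} : p\in\mathcal{P}_n(K),\ \|p\|_q\neq 0\right\}.$$ If $0<q\le\infty$ and $n\ge 2(1+1/q)\frac{d^2}{w^2}\ln\frac{d}{w}$ (with $1/q=0$ for $q=\infty$), then $$M_{n,q}(K)\le C_q\,\frac{w}{d^2}\,n,$$ where $$C_q=121\,\frac{3q+2+2\sqrt{q^2+3q+1}}{5q}\,\bigl(3+2q+2\sqrt{q^2+3q+1}\bigr)^{1/q}\quad(0<q<\infty),\qquad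 C_\infty=\lim_{q\to\infty}C_q=121.$$ In particular $M_{n,\infty}(K)\le 121\,\frac{w}{d^2}\,n$ whenever $n\ge 2\frac{d^2}{w^2}\ln\frac{d}{w}$. -/

import Mathlib

open MeasureTheory Polynomial
open scoped ENNReal

namespace TuranErod

/-- The extent of `K` in the direction determined by `γ`:
`max_{z, z' ∈ K} (Re (z e^{iγ}) - Re (z' e^{iγ}))`. -/
noncomputable def extent (K : Set ℂ) (γ : ℝ) : ℝ :=
  sSup {t : ℝ | ∃ z ∈ K, ∃ z' ∈ K,
    t = (z * Complex.exp (Complex.I * γ)).re - (z' * Complex.exp (Complex.I * γ)).re}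

/-- The (minimal) width `w(K) = min_{γ ∈ [-π, π]} max_{z, z' ∈ K} (Re (z e^{iγ}) - Re (z' e^{iγ}))`
of a compact set `K`. The diameter `d(K)` is `Metric.diam K`. -/
noncomputable def width (K : Set ℂ) : ℝ :=
  sInf (extent K '' Set.Icc (-Real.pi) Real.pi)

/-- Arc length on the boundary of `K`: the one-dimensional Hausdorff measure restricted to the
topological boundary `∂K`. -/
noncomputable def arcLength (K : Set ℂ) : Measure ℂ :=
  (Measure.hausdorffMeasure 1).restrict (frontier K)

/-- `‖p‖_q = ‖p‖_{L^q(K, μ)}`, which is `(∫_K |p|^q dμ)^{1/q}` for `0 < q < ∞` and the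
`μ`-essential supremum of `|p|` over `K` for `q = ∞`. -/
noncomputable def polyNorm (K : Set ℂ) (μ : Measure ℂ) (q : ℝ≥0∞) (p : ℂ[X]) : ℝ≥0∞ :=
  eLpNorm (fun z : ℂ => p.eval z) q (μ.restrict K)

/-- The class `𝒫_n(K)` of complex polynomials of degree exactly `n`, all of whose zeros
lie in `K`. -/
def polyClass (n : ℕ) (K : Set ℂ) : Set ℂ[X] :=
  {p | p.degree = (n : WithBot ℕ) ∧ ∀ z : ℂ, p.IsRoot z → z ∈ K}

/-- The inverse Markov factor
`M_{n,q}(K, μ) = inf {‖p'‖_q / ‖p‖_q : p ∈ 𝒫_n(K), ‖p‖_q ≠ 0}`, for a finite measure `μ`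
on a compact set `K`. -/
noncomputable def inverseMarkov (n : ℕ) (q : ℝ≥0∞) (K : Set ℂ) (μ : Measure ℂ) : ℝ≥0∞ :=
  sInf {r : ℝ≥0∞ | ∃ p ∈ polyClass n K, polyNorm K μ q p ≠ 0 ∧
    r = polyNorm K μ q (derivative p) / polyNorm K μ q p}

/-- The constant `C_q` for `0 < q < ∞`. -/
noncomputable def constC (q : ℝ) : ℝ :=
  121 * ((3 * q + 2 + 2 * √(q ^ 2 + 3 * q + 1)) / (5 * q)) *
    (3 + 2 * q + 2 * √(q ^ 2 + 3 * q + 1)) ^ (1 / q)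

end TuranErod

/-! One explicit polynomial is tested. Let `[a, b]` realise the diameter `d`, put `δ = w / d`, and
use the affine coordinate `ζ` sending `a, b` to `-1, 1`. The test polynomial is `p = (ζ - 1)^⌈n/2⌉
(ζ + 1)^⌊n/2⌋`, so that `p' / p = n (ζ + τ) / (ζ² - 1)` in this coordinate, with `τ = 0` or `1 / n`
by parity. On `K` both `|ζ ± 1| ≤ 2` and `|Im ζ| ≤ 4δ` hold (`IsDiameter.abs_im_coord_le`).

Where `|ζ + τ| ≤ 60 δ |ζ² - 1|`, the bound `|p'| ≤ 60 δ n |p|` is immediate. Elsewhere `|ζ² - 1| ≤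
exp(-2δ²)`, so `p'` is exponentially small, whereas `|p| ≥ m := (1 - δ²/4)^⌊n/2⌋ / 2` on the strip
`|Re ζ| ≤ δ / 2`. The size of `n` makes `|p'| ≤ 60 δ n δ^α m` there
(`norm_eval_derivative_modelPoly`). Passing from `ζ` to `z` costs a factor `2 / d`, which gives `120
(w / d²) n`.

For finite `q` take `α = 1 / q`. The exceptional points contribute at most `Λ^q δ m^q` times the
perimeter, which is at most `4d`; the boundary inside the strip has length at least `δ d`, so `δ d
m^q ≤ ∫ |p|^q`. Hence `∫ |p'|^q ≤ 5 Λ^q ∫ |p|^q`, and `5^(1/q) · 121 ≤ C_q`. For `q = ∞`, `α = 0`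
suffices. -/

namespace TuranErod

/-! ### The model polynomial with zeros at ±1 -/

/-- The polynomial `(X - 1) ^ j (X + 1) ^ k` of degree `n`, where `j = ⌈n / 2⌉` and `k = ⌊n / 2⌋`. -/
noncomputable def modelPoly (n : ℕ) : ℂ[X] := (X - C 1) ^ ((n + 1) / 2) * (X + C 1) ^ (n / 2)

/-- A lower bound for `modelPoly n` on the strip `|Re z| ≤ δ / 2`. -/
noncomputable def stripBound (n : ℕ) (δ : ℝ) : ℝ := (1 - δ ^ 2 / 4) ^ (n / 2) / 2

theorem stripBound_pos (n : ℕ) {δ : ℝ} (h0 : 0 < δ) (h1 : δ ≤ 1) : 0 < stripBound n δ := by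
  unfold stripBound
  have : 0 < 1 - δ ^ 2 / 4 := by nlinarith
  positivity

theorem natDegree_modelPoly (n : ℕ) : (modelPoly n).natDegree = n := by
  unfold modelPoly
  rw [natDegree_mul (pow_ne_zero _ (X_sub_C_ne_zero 1)) (pow_ne_zero _ (X_add_C_ne_zero 1)),
    natDegree_pow, natDegree_pow, natDegree_X_sub_C, natDegree_X_add_C]
  omega

theorem eval_modelPoly_even (k : ℕ) (z : ℂ) : (modelPoly (2 * k)).eval z = (z ^ 2 - 1) ^ k := by
  have h1 : (2 * k + 1) / 2 = k := by omega
  have h2 : 2 * k / 2 = k := by omega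
  simp only [modelPoly, h1, h2, eval_mul, eval_pow, eval_sub, eval_add, eval_X, eval_C, ← mul_pow]
  ring

theorem eval_modelPoly_odd (k : ℕ) (z : ℂ) :
    (modelPoly (2 * k + 1)).eval z = (z ^ 2 - 1) ^ k * (z - 1) := by
  have h1 : (2 * k + 1 + 1) / 2 = k + 1 := by omega
  have h2 : (2 * k + 1) / 2 = k := by omega
  simp only [modelPoly, h1, h2, eval_mul, eval_pow, eval_sub, eval_add, eval_X, eval_C]
  rw [pow_succ, show z ^ 2 - 1 = (z - 1) * (z + 1) by ring, mul_pow]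
  ring

theorem eval_derivative_modelPoly_even (k : ℕ) (z : ℂ) :
    (derivative (modelPoly (2 * (k + 1)))).eval z = (2 * (k + 1)) * z * (z ^ 2 - 1) ^ k := by
  have h1 : (2 * (k + 1) + 1) / 2 = k + 1 := by omega
  have h2 : 2 * (k + 1) / 2 = k + 1 := by omega
  have : modelPoly (2 * (k + 1)) = (X ^ 2 - 1) ^ (k + 1) := by
    simp only [modelPoly, h1, h2, ← mul_pow, map_one]
    ring
  rw [this, derivative_pow_succ]
  simp
  ring

theorem eval_derivative_modelPoly_odd (k : ℕ) (z : ℂ) :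
    (derivative (modelPoly (2 * (k + 1) + 1))).eval z =
      ((2 * (k + 1) + 1) * z + 1) * (z ^ 2 - 1) ^ k * (z - 1) := by
  have h1 : (2 * (k + 1) + 1 + 1) / 2 = k + 1 + 1 := by omega
  have h2 : (2 * (k + 1) + 1) / 2 = k + 1 := by omega
  have : modelPoly (2 * (k + 1) + 1) = (X ^ 2 - 1) ^ (k + 1) * (X - 1) := by
    simp only [modelPoly, h1, h2, map_one]
    rw [pow_succ (X - 1 : ℂ[X]) (k + 1), show (X ^ 2 - 1 : ℂ[X]) = (X - 1) * (X + 1) by ring,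
      mul_pow]
    ring
  rw [this, derivative_mul, derivative_pow_succ]
  simp
  ring

/-- The disk centred at the farther of `±1` gives `(1 + |x|)² + y² ≤ 4`. -/
theorem sq_re_add_sq_im_of_near {z : ℂ} (h1 : ‖z - 1‖ ≤ 2) (h2 : ‖z + 1‖ ≤ 2) :
    z.re ^ 2 + z.im ^ 2 + 2 * |z.re| ≤ 3 := by
  have e1 : ‖z - 1‖ ^ 2 = (z.re - 1) ^ 2 + z.im ^ 2 := by
    rw [Complex.sq_norm, Complex.normSq_apply]; simp; ring
  have e2 : ‖z + 1‖ ^ 2 = (z.re + 1) ^ 2 + z.im ^ 2 := by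
    rw [Complex.sq_norm, Complex.normSq_apply]; simp; ring
  have f1 : ‖z - 1‖ ^ 2 ≤ 4 := by nlinarith [norm_nonneg (z - 1)]
  have f2 : ‖z + 1‖ ^ 2 ≤ 4 := by nlinarith [norm_nonneg (z + 1)]
  cases abs_cases z.re <;> nlinarith

theorem abs_re_le_one_of_near {z : ℂ} (h1 : ‖z - 1‖ ≤ 2) (h2 : ‖z + 1‖ ≤ 2) : |z.re| ≤ 1 := by
  have := sq_re_add_sq_im_of_near h1 h2
  have h := abs_nonneg z.re
  rw [← sq_abs] at this
  nlinarith [sq_nonneg z.im]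

/-- Expanding gives `(1 - x²)² + y² (2 + 2x² + y²)`; in the lens `x² ≤ 1` and `y² ≤ 3`, so the
bracket is at most 7. -/
theorem norm_sq_sub_one_sq_le {z : ℂ} (h1 : ‖z - 1‖ ≤ 2) (h2 : ‖z + 1‖ ≤ 2) :
    ‖z ^ 2 - 1‖ ^ 2 ≤ 1 - z.re ^ 2 + 7 * z.im ^ 2 := by
  have h := sq_re_add_sq_im_of_near h1 h2
  have hx := abs_re_le_one_of_near h1 h2
  have hx2 : z.re ^ 2 ≤ 1 := by rw [← sq_abs]; nlinarith [abs_nonneg z.re]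
  have hy2 : z.im ^ 2 ≤ 3 := by nlinarith [abs_nonneg z.re, sq_nonneg z.re]
  have e : ‖z ^ 2 - 1‖ ^ 2 = (z.re ^ 2 - z.im ^ 2 - 1) ^ 2 + 4 * z.re ^ 2 * z.im ^ 2 := by
    rw [Complex.sq_norm, Complex.normSq_apply, sq z]; simp; ring
  rw [e]
  nlinarith [mul_nonneg (sq_nonneg z.re) (sub_nonneg.2 hx2),
    mul_nonneg (sq_nonneg z.im) (sub_nonneg.2 hx2), mul_nonneg (sq_nonneg z.im) (sub_nonneg.2 hy2)]

theorem norm_add_ofReal_le_two {z : ℂ} {τ : ℝ} (h1 : ‖z - 1‖ ≤ 2) (h2 : ‖z + 1‖ ≤ 2)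
    (hτ0 : 0 ≤ τ) (hτ1 : τ ≤ 1) : ‖z + τ‖ ≤ 2 := by
  have e : z + τ = ((1 + τ) / 2 : ℝ) * (z + 1) + ((1 - τ) / 2 : ℝ) * (z - 1) := by
    push_cast; ring
  rw [e]
  refine (norm_add_le _ _).trans ?_
  rw [norm_mul, norm_mul, Complex.norm_real, Complex.norm_real, Real.norm_of_nonneg (by linarith),
    Real.norm_of_nonneg (by linarith)]
  nlinarith

theorem exp_neg_mul_sq_le_rpow {δ α : ℝ} {n : ℕ} (h0 : 0 < δ)
    (hn : 2 * (1 + α) * (1 / δ ^ 2) * Real.log (1 / δ) ≤ n) :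
    Real.exp (-(n * δ ^ 2 / 2)) ≤ δ ^ (1 + α) := by
  rw [Real.rpow_def_of_pos h0, Real.exp_le_exp]
  rw [one_div δ, Real.log_inv] at hn
  have := mul_le_mul_of_nonneg_right hn (sq_nonneg δ)
  have e : 2 * (1 + α) * (1 / δ ^ 2) * -Real.log δ * δ ^ 2 = -(2 * (1 + α) * Real.log δ) := by
    field_simp
  nlinarith

theorem exp_neg_div_three_le {t : ℝ} (h0 : 0 ≤ t) (h1 : t ≤ 1) :
    Real.exp (-(t / 3)) ≤ 1 - t / 4 := by
  rw [Real.exp_neg]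
  apply inv_le_of_inv_le₀ (by linarith)
  refine le_trans ?_ (Real.add_one_le_exp _)
  rw [inv_le_iff_one_le_mul₀ (by linarith)]
  nlinarith

theorem exp_two_le : Real.exp 2 ≤ 15 / 2 := by
  have := Real.exp_one_lt_d9
  rw [show (2 : ℝ) = 1 + 1 by norm_num, Real.exp_add]
  nlinarith [Real.exp_pos 1]

/-- The factor `exp(-2δ²)^k` is split in two: `exp(-nδ²/2)` yields `δ^(1+α)` by the hypothesis on
`n`, and `exp(-δ²/3)^(k+1)` is dominated by the power in `stripBound`. Since `n ≤ 2k + 3`, the split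
loses at most `e² ≤ 15/2`, and `4 · 15/2 = 30 = 60 / 2`. -/
theorem four_mul_exp_le {δ α : ℝ} {n k : ℕ} (h0 : 0 < δ) (h1 : δ ≤ 1)
    (hk : n / 2 = k + 1)
    (hn : 2 * (1 + α) * (1 / δ ^ 2) * Real.log (1 / δ) ≤ n) :
    4 * n * Real.exp (-(2 * δ ^ 2)) ^ k ≤ 60 * δ * n * (δ ^ α * stripBound n δ) := by
  have hδ : δ ^ 2 ≤ 1 := by nlinarith
  have e1 := exp_neg_mul_sq_le_rpow h0 hn
  have e2 : Real.exp (-(δ ^ 2 / 3)) ^ (k + 1) ≤ (1 - δ ^ 2 / 4) ^ (k + 1) :=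
    pow_le_pow_left₀ (Real.exp_pos _).le (exp_neg_div_three_le (sq_nonneg _) hδ) _
  have e3 : 4 * Real.exp (-(2 * δ ^ 2)) ^ k ≤
      30 * (Real.exp (-(n * δ ^ 2 / 2)) * Real.exp (-(δ ^ 2 / 3)) ^ (k + 1)) := by
    rw [← Real.exp_nat_mul, ← Real.exp_nat_mul, ← Real.exp_add]
    have hn' : (n : ℝ) ≤ 2 * k + 3 := by
      have : n ≤ 2 * k + 3 := by omega
      exact_mod_cast this
    have h2 := exp_two_le
    have : Real.exp ((k : ℝ) * -(2 * δ ^ 2)) ≤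
        Real.exp 2 * Real.exp (-(n * δ ^ 2 / 2) + ((k + 1 : ℕ) : ℝ) * -(δ ^ 2 / 3)) := by
      rw [← Real.exp_add, Real.exp_le_exp]
      push_cast
      have := mul_le_mul_of_nonneg_right hn' (sq_nonneg δ)
      have hkk : 0 ≤ (k : ℝ) * δ ^ 2 := by positivity
      nlinarith
    nlinarith [Real.exp_pos (-(n * δ ^ 2 / 2) + ((k + 1 : ℕ) : ℝ) * -(δ ^ 2 / 3))]
  have e4 : Real.exp (-(n * δ ^ 2 / 2)) * Real.exp (-(δ ^ 2 / 3)) ^ (k + 1) ≤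
      δ ^ (1 + α) * (1 - δ ^ 2 / 4) ^ (k + 1) :=
    mul_le_mul e1 e2 (by positivity) (by positivity)
  have e5 : 60 * δ * n * (δ ^ α * stripBound n δ) =
      n * (30 * (δ ^ (1 + α) * (1 - δ ^ 2 / 4) ^ (k + 1))) := by
    rw [stripBound, hk, Real.rpow_add h0, Real.rpow_one]
    ring
  rw [e5, mul_comm (4 : ℝ), mul_assoc]
  exact mul_le_mul_of_nonneg_left (by linarith) (Nat.cast_nonneg n)

/-- Away from the critical point of `modelPoly n`, the factor `z ^ 2 - 1` is small. -/
theorem norm_sq_sub_one_le_exp {δ α τ : ℝ} {n : ℕ} {z : ℂ} (h0 : 0 < δ) (h1 : δ ≤ 1)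
    (hα : 0 ≤ α) (hn1 : 1 ≤ n)
    (hn : 2 * (1 + α) * (1 / δ ^ 2) * Real.log (1 / δ) ≤ n)
    (hz1 : ‖z - 1‖ ≤ 2) (hz2 : ‖z + 1‖ ≤ 2) (him : |z.im| ≤ 4 * δ)
    (hτ0 : 0 ≤ τ) (hτ : τ ≤ 1 / n) (hfar : 60 * δ * ‖z ^ 2 - 1‖ < ‖z + τ‖) :
    ‖z ^ 2 - 1‖ ≤ Real.exp (-(2 * δ ^ 2)) := by
  by_contra! hG
  have hnpos : (0 : ℝ) < n := by exact_mod_cast hn1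
  have hδ : δ ^ 2 ≤ 1 := by nlinarith
  have hτ1 : τ ≤ 1 := hτ.trans ((div_le_one hnpos).2 (by exact_mod_cast hn1))
  have hz := norm_add_ofReal_le_two hz1 hz2 hτ0 hτ1
  have hexp2 : 2 / 15 ≤ Real.exp (-(2 * δ ^ 2)) := by
    have h := exp_two_le
    have h3 : (2 / 15 : ℝ) ≤ Real.exp (-2) := by
      rw [Real.exp_neg, show (2 / 15 : ℝ) = (15 / 2)⁻¹ by norm_num]
      exact inv_anti₀ (Real.exp_pos 2) h
    exact h3.trans (Real.exp_le_exp.2 (by linarith))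
  -- From `60 δ · 2/15 < |z + τ| ≤ 2`.
  have hδ4 : δ ≤ 1 / 4 := by nlinarith
  have hlin : 1 - 2 * δ ^ 2 ≤ Real.exp (-(2 * δ ^ 2)) := by
    linarith [Real.add_one_le_exp (-(2 * δ ^ 2))]
  have hlog : 1 ≤ Real.log (1 / δ) := by
    rw [Real.le_log_iff_exp_le (by positivity)]
    have := Real.exp_one_lt_d9
    have : 4 ≤ 1 / δ := by rw [le_div_iff₀ h0]; linarith
    linarith
  have hnδ : 2 * (1 / δ ^ 2) ≤ n := by
    refine le_trans ?_ hn
    have : 0 < 1 / δ ^ 2 := by positivity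
    nlinarith [mul_nonneg hα this.le]
  have hτδ : τ ≤ δ := by
    refine hτ.trans ?_
    rw [div_le_iff₀ hnpos]
    have h3 : δ * (2 * (1 / δ ^ 2)) = 2 / δ := by field_simp
    have h4 : 1 ≤ 2 / δ := by rw [le_div_iff₀ h0]; linarith
    nlinarith
  have hbig : 51 * δ < ‖z + τ‖ := by
    have : 7 / 8 ≤ ‖z ^ 2 - 1‖ := by nlinarith
    nlinarith
  have htri : ‖z + τ‖ ≤ |z.re| + |z.im| + τ := by
    refine (norm_add_le _ _).trans ?_
    rw [Complex.norm_real, Real.norm_of_nonneg hτ0]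
    linarith [Complex.norm_le_abs_re_add_abs_im z]
  -- `51δ` less `4δ` for the imaginary part and `δ` for `τ`. Then `|z² - 1|² ≤ 1 - 2116δ² + 112δ²`,
  -- which is below `(1 - 2δ²)²`.
  have hx : 46 * δ ≤ |z.re| := by linarith
  have hx2 : 2116 * δ ^ 2 ≤ z.re ^ 2 := by rw [← sq_abs z.re]; nlinarith
  have hy2 : z.im ^ 2 ≤ 16 * δ ^ 2 := by rw [← sq_abs z.im]; nlinarith [abs_nonneg z.im]
  have hG2 := norm_sq_sub_one_sq_le hz1 hz2
  have : (1 - 2 * δ ^ 2) ^ 2 ≤ ‖z ^ 2 - 1‖ ^ 2 :=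
    pow_le_pow_left₀ (by nlinarith) (by linarith) 2
  nlinarith [sq_pos_of_pos h0]

/-- Real parts give `|z ∓ 1| ≥ 1 ∓ Re z`, hence `|z² - 1| ≥ 1 - δ²/4`. The factor `1/2` in
`stripBound` pays for the unpaired `z - 1` when `n` is odd. -/
theorem stripBound_le_norm_eval {δ : ℝ} (n : ℕ) {z : ℂ} (h0 : 0 < δ) (h1 : δ ≤ 1)
    (hre : |z.re| ≤ δ / 2) : stripBound n δ ≤ ‖(modelPoly n).eval z‖ := by
  have hre2 : z.re ^ 2 ≤ δ ^ 2 / 4 := by rw [← sq_abs]; nlinarith [abs_nonneg z.re]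
  have hb : 0 ≤ 1 - δ ^ 2 / 4 := by nlinarith
  have ha := abs_le.1 hre
  have h3 : 1 - z.re ≤ ‖z - 1‖ := by
    have := Complex.abs_re_le_norm (z - 1)
    rw [abs_le] at this
    simp at this
    linarith
  have h4 : 1 + z.re ≤ ‖z + 1‖ := by
    have := Complex.abs_re_le_norm (z + 1)
    rw [abs_le] at this
    simp at this
    linarith
  have hG : 1 - δ ^ 2 / 4 ≤ ‖z ^ 2 - 1‖ := by
    rw [show z ^ 2 - 1 = (z - 1) * (z + 1) by ring, norm_mul]
    have := mul_le_mul h3 h4 (by linarith) (norm_nonneg _)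
    nlinarith
  have hp := pow_le_pow_left₀ hb hG (n / 2)
  have hp0 : 0 ≤ (1 - δ ^ 2 / 4) ^ (n / 2) := pow_nonneg hb _
  unfold stripBound
  rcases Nat.even_or_odd' n with ⟨k, rfl | rfl⟩
  · rw [eval_modelPoly_even, norm_pow]
    rw [show 2 * k / 2 = k by omega] at *
    linarith
  · rw [eval_modelPoly_odd, norm_mul, norm_pow]
    rw [show (2 * k + 1) / 2 = k by omega] at *
    have : 1 / 2 ≤ ‖z - 1‖ := by linarith
    nlinarith

theorem norm_eval_derivative_modelPoly {δ α : ℝ} {n : ℕ} {z : ℂ} (h0 : 0 < δ) (h1 : δ ≤ 1)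
    (hα : 0 ≤ α) (hn : 2 * (1 + α) * (1 / δ ^ 2) * Real.log (1 / δ) ≤ n)
    (hz1 : ‖z - 1‖ ≤ 2) (hz2 : ‖z + 1‖ ≤ 2) (him : |z.im| ≤ 4 * δ) :
    ‖(derivative (modelPoly n)).eval z‖ ≤ 60 * δ * n * ‖(modelPoly n).eval z‖ ∨
    ‖(derivative (modelPoly n)).eval z‖ ≤ 60 * δ * n * (δ ^ α * stripBound n δ) := by
  rcases Nat.even_or_odd' n with ⟨k, hk | hk⟩
  · rcases k with _ | k
    · left
      subst hk
      simp [modelPoly]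
    have hfour := four_mul_exp_le (k := k) h0 h1 (by omega) hn
    have hnr : (n : ℝ) = 2 * (k + 1) := by rw [hk]; push_cast; ring
    have hd : ‖(derivative (modelPoly n)).eval z‖ = n * ‖z‖ * ‖z ^ 2 - 1‖ ^ k := by
      rw [hk, eval_derivative_modelPoly_even, norm_mul, norm_mul, norm_pow]
      congr 2
      rw [← Complex.norm_natCast]
      push_cast
      rfl
    have hp : ‖(modelPoly n).eval z‖ = ‖z ^ 2 - 1‖ ^ k * ‖z ^ 2 - 1‖ := by
      rw [hk, eval_modelPoly_even, norm_pow, pow_succ]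
    have hzle : ‖z‖ ≤ 2 := by simpa using norm_add_ofReal_le_two hz1 hz2 le_rfl zero_le_one
    by_cases hfar : 60 * δ * ‖z ^ 2 - 1‖ < ‖z‖
    · right
      have hG := norm_sq_sub_one_le_exp (τ := 0) h0 h1 hα (by omega) hn hz1 hz2 him le_rfl
        (by positivity) (by simpa using hfar)
      rw [hd]
      refine le_trans ?_ hfour
      calc n * ‖z‖ * ‖z ^ 2 - 1‖ ^ k
          ≤ n * 4 * Real.exp (-(2 * δ ^ 2)) ^ k := by gcongr; linarith
        _ = 4 * n * Real.exp (-(2 * δ ^ 2)) ^ k := by ring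
    · left
      rw [hd, hp]
      have : 0 ≤ n * ‖z ^ 2 - 1‖ ^ k := by positivity
      nlinarith
  · rcases k with _ | k
    -- For `n = 1` the derivative is 1, and the hypothesis forces `δ^(1+α) ≥ exp(-δ²/2) ≥ 1/2`.
    · right
      have h5 := exp_neg_mul_sq_le_rpow h0 hn
      subst hk
      have h6 := Real.add_one_le_exp (-(((2 * 0 + 1 : ℕ) : ℝ) * δ ^ 2 / 2))
      rw [Real.rpow_add h0, Real.rpow_one] at h5
      push_cast at *
      simp [modelPoly, stripBound]
      nlinarith
    have hfour := four_mul_exp_le (k := k) h0 h1 (by omega) hn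
    have hnr : (n : ℝ) = 2 * (k + 1) + 1 := by rw [hk]; push_cast; ring
    have hnpos : (0 : ℝ) < n := by rw [hnr]; positivity
    have hnC : (n : ℂ) ≠ 0 := by exact_mod_cast hnpos.ne'
    have hd : ‖(derivative (modelPoly n)).eval z‖ =
        n * ‖z + (1 / n : ℝ)‖ * ‖z ^ 2 - 1‖ ^ k * ‖z - 1‖ := by
      have : ((2 * (k + 1) + 1) * z + 1 : ℂ) = n * (z + (1 / n : ℝ)) := by
        push_cast
        field_simp
        rw [hk]; push_cast; ring
      rw [hk, eval_derivative_modelPoly_odd, this, ← hk, norm_mul, norm_mul, norm_mul, norm_pow,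
        Complex.norm_natCast]
    have hp : ‖(modelPoly n).eval z‖ = ‖z ^ 2 - 1‖ ^ k * ‖z ^ 2 - 1‖ * ‖z - 1‖ := by
      rw [hk, eval_modelPoly_odd, norm_mul, norm_pow, pow_succ]
    by_cases hfar : 60 * δ * ‖z ^ 2 - 1‖ < ‖z + (1 / n : ℝ)‖
    · right
      have hG := norm_sq_sub_one_le_exp h0 h1 hα (by omega) hn hz1 hz2 him (by positivity)
        le_rfl hfar
      rw [hd]
      refine le_trans ?_ hfour
      have hn1 : (1 : ℝ) ≤ n := by rw [hnr]; linarith [Nat.cast_nonneg (α := ℝ) k]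
      have hτ1 : (1 : ℝ) / n ≤ 1 := by rw [div_le_one hnpos]; exact hn1
      have hτ0 : (0 : ℝ) ≤ 1 / n := by positivity
      have hz := norm_add_ofReal_le_two hz1 hz2 hτ0 hτ1
      calc n * ‖z + (1 / n : ℝ)‖ * ‖z ^ 2 - 1‖ ^ k * ‖z - 1‖
          ≤ n * 2 * Real.exp (-(2 * δ ^ 2)) ^ k * 2 := by gcongr
        _ = 4 * n * Real.exp (-(2 * δ ^ 2)) ^ k := by ring
    · left
      rw [hd, hp]
      have : 0 ≤ n * ‖z ^ 2 - 1‖ ^ k * ‖z - 1‖ := by positivity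
      nlinarith

/-! ### Extent, width and interior -/

theorem norm_exp_I_mul (γ : ℝ) : ‖Complex.exp (Complex.I * γ)‖ = 1 := by
  rw [mul_comm, Complex.norm_exp_ofReal_mul_I]

theorem re_mul_sub_re_mul_le_diam {K : Set ℂ} (hK : IsCompact K) (γ : ℝ) {z z' : ℂ} (hz : z ∈ K)
    (hz' : z' ∈ K) :
    (z * Complex.exp (Complex.I * γ)).re - (z' * Complex.exp (Complex.I * γ)).re
      ≤ Metric.diam K := by
  rw [← Complex.sub_re, ← sub_mul]
  refine (Complex.re_le_norm _).trans ?_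
  rw [norm_mul, norm_exp_I_mul, mul_one, ← dist_eq_norm]
  exact Metric.dist_le_diam_of_mem hK.isBounded hz hz'

theorem re_mul_sub_re_mul_le_extent {K : Set ℂ} (hK : IsCompact K) (γ : ℝ) {z z' : ℂ}
    (hz : z ∈ K) (hz' : z' ∈ K) :
    (z * Complex.exp (Complex.I * γ)).re - (z' * Complex.exp (Complex.I * γ)).re ≤ extent K γ := by
  refine le_csSup ⟨Metric.diam K, ?_⟩ ⟨z, hz, z', hz', rfl⟩
  rintro _ ⟨x, hx, y, hy, rfl⟩
  exact re_mul_sub_re_mul_le_diam hK γ hx hy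

theorem extent_le_diam {K : Set ℂ} (hK : IsCompact K) (γ : ℝ) : extent K γ ≤ Metric.diam K := by
  refine Real.sSup_le ?_ Metric.diam_nonneg
  rintro _ ⟨x, hx, y, hy, rfl⟩
  exact re_mul_sub_re_mul_le_diam hK γ hx hy

theorem extent_nonneg {K : Set ℂ} (hK : IsCompact K) (γ : ℝ) : 0 ≤ extent K γ := by
  rcases K.eq_empty_or_nonempty with rfl | ⟨z, hz⟩
  · simp [extent]
  · simpa using re_mul_sub_re_mul_le_extent hK γ hz hz

theorem width_le_extent {K : Set ℂ} (hK : IsCompact K) {γ : ℝ}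
    (hγ : γ ∈ Set.Icc (-Real.pi) Real.pi) : width K ≤ extent K γ := by
  refine csInf_le ⟨0, ?_⟩ ⟨γ, hγ, rfl⟩
  rintro _ ⟨x, -, rfl⟩
  exact extent_nonneg hK x

theorem width_le_diam {K : Set ℂ} (hK : IsCompact K) : width K ≤ Metric.diam K :=
  (width_le_extent hK (γ := 0) ⟨by linarith [Real.pi_pos], Real.pi_pos.le⟩).trans
    (extent_le_diam hK 0)

theorem le_width {K : Set ℂ} {t : ℝ} (h : ∀ γ : ℝ, t ≤ extent K γ) : t ≤ width K := by
  refine le_csInf (Set.Nonempty.image _ ⟨0, by linarith [Real.pi_pos], Real.pi_pos.le⟩) ?_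
  rintro _ ⟨γ, -, rfl⟩
  exact h γ

/-- The extent vanishes in the direction `γ = arg c`. -/
theorem width_nonpos_of_re_mul_eq {K : Set ℂ} (hK : IsCompact K) {c : ℂ} (hc : c ≠ 0)
    (h : ∀ z ∈ K, ∀ z' ∈ K, (z * c).re = (z' * c).re) : width K ≤ 0 := by
  refine (width_le_extent hK (γ := c.arg)
    ⟨(Complex.neg_pi_lt_arg c).le, Complex.arg_le_pi c⟩).trans ?_
  refine Real.sSup_le ?_ le_rfl
  rintro _ ⟨x, hx, y, hy, rfl⟩
  have hpos : 0 < ‖c‖ := norm_pos_iff.2 hc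
  have h1 : ∀ z : ℂ, (z * Complex.exp (Complex.I * c.arg)).re * ‖c‖ = (z * c).re := by
    intro z
    rw [← Complex.re_mul_ofReal, mul_assoc]
    congr 2
    rw [mul_comm, mul_comm Complex.I, Complex.norm_mul_exp_arg_mul_I]
  have h2 := h x hx y hy
  rw [← h1, ← h1] at h2
  rw [mul_right_cancel₀ hpos.ne' h2, sub_self]

/-- Otherwise the affine span is proper, so some nonzero real functional, necessarily of the form `z
↦ Re (z c)`, is constant on `K`, and the width vanishes. -/
theorem interior_nonempty_of_width_pos {K : Set ℂ} (hK : IsCompact K) (hconv : Convex ℝ K)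
    (hne : K.Nonempty) (hw : 0 < width K) : (interior K).Nonempty := by
  rw [hconv.interior_nonempty_iff_affineSpan_eq_top,
    AffineSubspace.affineSpan_eq_top_iff_vectorSpan_eq_top_of_nonempty _ _ _ hne]
  by_contra hV
  obtain ⟨f, hf, hker⟩ := Submodule.exists_le_ker_of_lt_top _ (lt_top_iff_ne_top.2 hV)
  have hfv : ∀ z : ℂ, f z = (z * ⟨f 1, -f Complex.I⟩).re := by
    intro z
    have : z = z.re • (1 : ℂ) + z.im • Complex.I := by
      simp [Complex.re_add_im]
    conv_lhs => rw [this]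
    rw [map_add, map_smul, map_smul]
    simp
  refine hw.not_ge (width_nonpos_of_re_mul_eq hK (c := ⟨f 1, -f Complex.I⟩) ?_ ?_)
  · intro h0
    apply hf
    refine LinearMap.ext fun z => ?_
    rw [hfv, h0, mul_zero, Complex.zero_re, LinearMap.zero_apply]
  · intro z hz z' hz'
    have := hker (vsub_mem_vectorSpan ℝ hz hz')
    rw [LinearMap.mem_ker, vsub_eq_sub, map_sub, sub_eq_zero] at this
    rw [← hfv, ← hfv, this]

/-! ### The coordinate adapted to a diameter -/

/-- The affine coordinate on `ℂ` which takes the values `-1` at `a` and `1` at `b`. -/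
noncomputable def coord (a b z : ℂ) : ℂ := (2 * z - a - b) / (b - a)

theorem coord_sub_one {a b : ℂ} (hab : a ≠ b) (z : ℂ) :
    coord a b z - 1 = 2 / (b - a) * (z - b) := by
  have : b - a ≠ 0 := sub_ne_zero.2 hab.symm
  unfold coord; field_simp; ring

theorem coord_add_one {a b : ℂ} (hab : a ≠ b) (z : ℂ) :
    coord a b z + 1 = 2 / (b - a) * (z - a) := by
  have : b - a ≠ 0 := sub_ne_zero.2 hab.symm
  unfold coord; field_simp; ring

theorem coord_add_mul {a b : ℂ} (hab : a ≠ b) (z c : ℂ) :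
    coord a b (z + c * (b - a)) = coord a b z + 2 * c := by
  have : b - a ≠ 0 := sub_ne_zero.2 hab.symm
  unfold coord; field_simp; ring

theorem coord_left {a b : ℂ} (hab : a ≠ b) : coord a b a = -1 := by
  rw [eq_neg_iff_add_eq_zero, coord_add_one hab]; simp

theorem coord_right {a b : ℂ} (hab : a ≠ b) : coord a b b = 1 := by
  rw [← sub_eq_zero, coord_sub_one hab]; simp

theorem coord_combo (a b z z' : ℂ) {s t : ℝ} (h : s + t = 1) :
    coord a b (s • z + t • z') = s * coord a b z + t * coord a b z' := by
  have h' : (s : ℂ) + t = 1 := by exact_mod_cast h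
  unfold coord
  simp only [Complex.real_smul]
  rw [← mul_div_assoc, ← mul_div_assoc, ← add_div]
  congr 1
  linear_combination (a + b) * h'

theorem continuous_coord (a b : ℂ) : Continuous (coord a b) := by
  unfold coord; fun_prop

/-- A segment realizing the diameter. -/
structure IsDiameter (K : Set ℂ) (a b : ℂ) : Prop where
  left_mem : a ∈ K
  right_mem : b ∈ K
  dist_eq : dist a b = Metric.diam K

theorem exists_isDiameter {K : Set ℂ} (hK : IsCompact K) (hne : K.Nonempty) :
    ∃ a b, IsDiameter K a b := by
  obtain ⟨⟨a, b⟩, ⟨ha, hb⟩, hmax⟩ := (hK.prod hK).exists_isMaxOn (hne.prod hne)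
    (f := fun p : ℂ × ℂ => dist p.1 p.2) (by fun_prop)
  refine ⟨a, b, ha, hb, le_antisymm (Metric.dist_le_diam_of_mem hK.isBounded ha hb) ?_⟩
  exact Metric.diam_le_of_forall_dist_le dist_nonneg fun x hx y hy => hmax (Set.mk_mem_prod hx hy)

namespace IsDiameter

variable {K : Set ℂ} {a b : ℂ}

theorem ne (h : IsDiameter K a b) (hd : 0 < Metric.diam K) : a ≠ b := by
  rw [← dist_pos, h.dist_eq]; exact hd

theorem norm_sub (h : IsDiameter K a b) : ‖b - a‖ = Metric.diam K := by
  rw [← h.dist_eq, dist_comm, dist_eq_norm]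

theorem norm_coord_sub_one_le (h : IsDiameter K a b) (hK : IsCompact K) (hd : 0 < Metric.diam K)
    {z : ℂ} (hz : z ∈ K) : ‖coord a b z - 1‖ ≤ 2 := by
  rw [coord_sub_one (h.ne hd), norm_mul, norm_div, h.norm_sub, Complex.norm_two, div_mul_eq_mul_div,
    div_le_iff₀ hd, ← dist_eq_norm]
  linarith [Metric.dist_le_diam_of_mem hK.isBounded hz h.right_mem]

theorem norm_coord_add_one_le (h : IsDiameter K a b) (hK : IsCompact K) (hd : 0 < Metric.diam K)
    {z : ℂ} (hz : z ∈ K) : ‖coord a b z + 1‖ ≤ 2 := by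
  rw [coord_add_one (h.ne hd), norm_mul, norm_div, h.norm_sub, Complex.norm_two, div_mul_eq_mul_div,
    div_le_iff₀ hd, ← dist_eq_norm]
  linarith [Metric.dist_le_diam_of_mem hK.isBounded hz h.left_mem]

/-- For any direction, with extent `E`, rotate `b - a` to `v`. Then `|Re v| ≤ E` and `|Re (v ζ)| ≤
2E`, so `|Im v · Im ζ| ≤ 3E`. As `|v| = d` and `(Im ζ)² ≤ 3`, it follows that `(d Im ζ)² ≤ 3E² + 9E²
≤ (4E)²`. -/
theorem abs_im_coord_le (h : IsDiameter K a b) (hK : IsCompact K) (hd : 0 < Metric.diam K)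
    {z : ℂ} (hz : z ∈ K) : |(coord a b z).im| ≤ 4 * (width K / Metric.diam K) := by
  suffices H : |(coord a b z).im| * Metric.diam K / 4 ≤ width K by
    rw [← mul_div_assoc, le_div_iff₀ hd]; linarith
  have hz1 := h.norm_coord_sub_one_le hK hd hz
  have hz2 := h.norm_coord_add_one_le hK hd hz
  refine le_width fun γ => ?_
  have hba : b - a ≠ 0 := sub_ne_zero.2 (h.ne hd).symm
  set E := extent K γ with hE
  have hE0 : 0 ≤ E := extent_nonneg hK γ
  have key : ∀ x ∈ K, ∀ y ∈ K, ((x - y) * Complex.exp (Complex.I * γ)).re ≤ E := by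
    intro x hx y hy
    rw [sub_mul, Complex.sub_re]
    exact re_mul_sub_re_mul_le_extent hK γ hx hy
  set e := Complex.exp (Complex.I * γ) with he
  set v := (b - a) * e with hv
  have hvn : ‖v‖ = Metric.diam K := by rw [hv, norm_mul, norm_exp_I_mul, mul_one, h.norm_sub]
  have hvs : v.re ^ 2 + v.im ^ 2 = Metric.diam K ^ 2 := by
    rw [← hvn, Complex.sq_norm, Complex.normSq_apply]; ring
  have h1 := key b h.right_mem a h.left_mem
  have h2 := key a h.left_mem b h.right_mem
  rw [← neg_sub, neg_mul, Complex.neg_re] at h2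
  have hv1 : |v.re| ≤ E := abs_le.2 ⟨by linarith, h1⟩
  have h3 := key z hz a h.left_mem
  have h4 := key z hz b h.right_mem
  have h5 := key a h.left_mem z hz
  have h6 := key b h.right_mem z hz
  set ζ := coord a b z with hζ
  have hvζ : v * ζ = (z - a) * e + (z - b) * e := by
    rw [hζ, hv, coord]; field_simp; ring
  have hvζ' : v * ζ = -((a - z) * e + (b - z) * e) := by rw [hvζ]; ring
  have h7 : (v * ζ).re ≤ 2 * E := by rw [hvζ, Complex.add_re]; linarith
  have h8 : -(2 * E) ≤ (v * ζ).re := by rw [hvζ', Complex.neg_re, Complex.add_re]; linarith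
  rw [Complex.mul_re] at h7 h8
  have hx := abs_re_le_one_of_near hz1 hz2
  have hy : ζ.im ^ 2 ≤ 3 := by
    nlinarith [sq_re_add_sq_im_of_near hz1 hz2, abs_nonneg ζ.re, sq_nonneg ζ.re]
  have h9 : |v.re * ζ.re| ≤ E := by
    rw [abs_mul]; nlinarith [abs_nonneg v.re, abs_nonneg ζ.re]
  have h10 : |v.im * ζ.im| ≤ 3 * E := by
    have := abs_le.1 h9
    exact abs_le.2 ⟨by linarith, by linarith⟩
  have h11 : (v.im * ζ.im) ^ 2 ≤ 9 * E ^ 2 := by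
    rw [← sq_abs]; nlinarith [abs_nonneg (v.im * ζ.im)]
  have h12 : v.re ^ 2 ≤ E ^ 2 := by rw [← sq_abs]; nlinarith [abs_nonneg v.re]
  have h13 : (|ζ.im| * Metric.diam K) ^ 2 ≤ (4 * E) ^ 2 := by
    rw [mul_pow, sq_abs, ← hvs]
    nlinarith [sq_nonneg v.re, sq_nonneg ζ.im]
  have := (sq_le_sq₀ (by positivity) (by positivity)).1 h13
  linarith

end IsDiameter

/-! ### Upper bound for the perimeter -/

theorem mem_frontier_of_forall_add_notMem {B : Set ℂ} {z v : ℂ} (hz : z ∈ B)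
    (h : ∀ t : ℝ, 0 < t → z + t * v ∉ B) : z ∈ frontier B := by
  refine ⟨subset_closure hz, fun hi => ?_⟩
  have hc : Filter.Tendsto (fun t : ℝ => z + t * v) (nhdsWithin 0 (Set.Ioi 0)) (nhds z) := by
    have : Continuous fun t : ℝ => z + t * v := by fun_prop
    simpa using (this.tendsto 0).mono_left nhdsWithin_le_nhds
  have h1 := hc.eventually (mem_interior_iff_mem_nhds.1 hi)
  obtain ⟨t, ht, ht0⟩ := (h1.and self_mem_nhdsWithin).exists
  exact h t ht0 ht

/-- The last point of the ray that lies in `B` is a boundary point. -/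
theorem exists_add_mem_frontier {B : Set ℂ} (hB : IsCompact B) {z v : ℂ} (hz : z ∈ B)
    (hv : v ≠ 0) : ∃ t : ℝ, 0 ≤ t ∧ z + t * v ∈ frontier B := by
  have hcl : IsClosed {t : ℝ | 0 ≤ t ∧ z + t * v ∈ B} :=
    isClosed_Ici.inter (hB.isClosed.preimage (f := fun t : ℝ => z + t * v) (by fun_prop))
  have hvp : 0 < ‖v‖ := norm_pos_iff.2 hv
  have hbd : Bornology.IsBounded {t : ℝ | 0 ≤ t ∧ z + t * v ∈ B} := by
    refine (Metric.isBounded_Icc 0 (Metric.diam B / ‖v‖)).subset fun t ht => ⟨ht.1, ?_⟩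
    have := Metric.dist_le_diam_of_mem hB.isBounded ht.2 hz
    rw [dist_eq_norm, add_sub_cancel_left, norm_mul, Complex.norm_real,
      Real.norm_of_nonneg ht.1] at this
    rwa [le_div_iff₀ hvp]
  obtain ⟨t, ht, hmax⟩ := (Metric.isCompact_of_isClosed_isBounded hcl hbd).exists_isMaxOn
    ⟨0, le_rfl, by simpa using hz⟩ continuousOn_id
  refine ⟨t, ht.1, mem_frontier_of_forall_add_notMem (v := v) ht.2 fun s hs hmem => ?_⟩
  have : t + s ≤ t := hmax (a := t + s) ⟨add_nonneg ht.1 hs.le, by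
    convert hmem using 1; push_cast; ring⟩
  linarith

theorem exists_supporting {K : Set ℂ} (hconv : Convex ℝ K) (hint : (interior K).Nonempty) {z : ℂ}
    (hz : z ∈ frontier K) : ∃ v : ℂ, v ≠ 0 ∧ ∀ k ∈ K, inner ℝ v (k - z) ≤ 0 := by
  obtain ⟨f, hf⟩ := geometric_hahn_banach_open_point hconv.interior isOpen_interior hz.2
  have hfv : ∀ x, inner ℝ ((InnerProductSpace.toDual ℝ ℂ).symm f) x = f x := fun x => by
    simp
  refine ⟨(InnerProductSpace.toDual ℝ ℂ).symm f, ?_, fun k hk => ?_⟩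
  · intro h0
    obtain ⟨x, hx⟩ := hint
    have := hf x hx
    rw [← hfv, ← hfv, h0] at this
    simp at this
  · rw [hfv, map_sub, sub_nonpos]
    have hk' : k ∈ closure (interior K) := by
      rw [hconv.closure_interior_eq_closure_of_nonempty_interior hint]
      exact subset_closure hk
    have hcl : IsClosed {x | f x ≤ f z} := isClosed_le f.continuous continuous_const
    exact hcl.closure_subset_iff.2 (fun x hx => (hf x hx).le) hk'

/-- The boundary of a convex body is not longer than the boundary of a compact set around it. -/
theorem hausdorffMeasure_frontier_mono {K B : Set ℂ} (hK : IsClosed K) (hconv : Convex ℝ K)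
    (hint : (interior K).Nonempty) (hB : IsCompact B) (hKB : K ⊆ B) :
    Measure.hausdorffMeasure 1 (frontier K) ≤ Measure.hausdorffMeasure 1 (frontier B) := by
  -- Each boundary point of `K` is pushed along an outward normal until it reaches the boundary of
  -- `B`. The push does not decrease distances, so its inverse is 1-Lipschitz.
  have hex : ∀ z : ℂ, ∃ u : ℂ, z ∈ frontier K →
      u ∈ frontier B ∧ ∀ k ∈ K, inner ℝ (u - z) (k - z) ≤ 0 := by
    intro z
    by_cases hz : z ∈ frontier K
    · obtain ⟨v, hv, hvk⟩ := exists_supporting hconv hint hz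
      obtain ⟨t, ht, hmem⟩ := exists_add_mem_frontier hB (hKB (hK.frontier_subset hz)) hv
      refine ⟨_, fun _ => ⟨hmem, fun k hk => ?_⟩⟩
      rw [add_sub_cancel_left, ← Complex.real_smul, real_inner_smul_left]
      exact mul_nonpos_of_nonneg_of_nonpos ht (hvk k hk)
    · exact ⟨0, fun h => absurd h hz⟩
  choose u hu using hex
  have hexp : ∀ z ∈ frontier K, ∀ z' ∈ frontier K, dist z z' ≤ dist (u z) (u z') := by
    intro z hz z' hz'
    have h1 := (hu z hz).2 z' (hK.frontier_subset hz')
    have h2 := (hu z' hz').2 z (hK.frontier_subset hz)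
    -- The displacements `u z - z` and `u z' - z'` are outward normals, so each contributes with a
    -- favourable sign; Cauchy–Schwarz then gives the expansion.
    have h3 : ‖z - z'‖ ^ 2 ≤ inner ℝ (u z - u z') (z - z') := by
      rw [← real_inner_self_eq_norm_sq (z - z')]
      have e1 : u z - u z' = (u z - z) + (z - z') - (u z' - z') := by ring
      have e2 : inner ℝ (u z - z) (z - z') = -inner ℝ (u z - z) (z' - z) := by
        rw [← inner_neg_right, neg_sub]
      rw [e1, inner_sub_left (u z - z + (z - z')), inner_add_left (u z - z), e2]
      linarith
    have h4 := h3.trans (real_inner_le_norm _ _)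
    rw [dist_eq_norm, dist_eq_norm]
    rcases (norm_nonneg (z - z')).eq_or_lt with h0 | h0
    · rw [← h0]; positivity
    · nlinarith
  have hinj : Set.InjOn u (frontier K) := fun z hz z' hz' h => by
    have := hexp z hz z' hz'
    rw [h, dist_self] at this
    exact dist_le_zero.1 this
  have hlip : LipschitzOnWith 1 (Function.invFunOn u (frontier K)) (u '' frontier K) := by
    refine LipschitzOnWith.of_dist_le_mul ?_
    rintro _ ⟨z, hz, rfl⟩ _ ⟨z', hz', rfl⟩
    rw [hinj.leftInvOn_invFunOn hz, hinj.leftInvOn_invFunOn hz', NNReal.coe_one, one_mul]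
    exact hexp z hz z' hz'
  have himg : Function.invFunOn u (frontier K) '' (u '' frontier K) = frontier K :=
    hinj.leftInvOn_invFunOn.image_image
  calc Measure.hausdorffMeasure 1 (frontier K)
      = Measure.hausdorffMeasure 1 (Function.invFunOn u (frontier K) '' (u '' frontier K)) := by
        rw [himg]
    _ ≤ ((1 : NNReal) : ℝ≥0∞) ^ (1 : ℝ) * Measure.hausdorffMeasure 1 (u '' frontier K) :=
        hlip.hausdorffMeasure_image_le zero_le_one
    _ = Measure.hausdorffMeasure 1 (u '' frontier K) := by simp
    _ ≤ _ := measure_mono (Set.image_subset_iff.2 fun z hz => (hu z hz).1)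

theorem hausdorffMeasure_frontier_rect_le {x₀ x₁ y₀ y₁ D : ℝ} (hx : x₀ ≤ x₁) (hy : y₀ ≤ y₁)
    (hxD : x₁ - x₀ ≤ D) (hyD : y₁ - y₀ ≤ D) :
    Measure.hausdorffMeasure 1 (frontier (Set.Icc x₀ x₁ ×ℂ Set.Icc y₀ y₁)) ≤
      4 * ENNReal.ofReal D := by
  have hH : ∀ y : ℝ, Measure.hausdorffMeasure 1 ((fun t : ℝ => (⟨t, y⟩ : ℂ)) '' Set.Icc x₀ x₁) ≤
      ENNReal.ofReal D := by
    intro y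
    have hi : Isometry fun t : ℝ => (⟨t, y⟩ : ℂ) := Isometry.of_dist_eq fun s t => by
      exact Complex.dist_of_im_eq rfl
    rw [hi.hausdorffMeasure_image (Or.inl zero_le_one), hausdorffMeasure_real, Real.volume_Icc]
    exact ENNReal.ofReal_le_ofReal hxD
  have hV : ∀ x : ℝ, Measure.hausdorffMeasure 1 ((fun t : ℝ => (⟨x, t⟩ : ℂ)) '' Set.Icc y₀ y₁) ≤
      ENNReal.ofReal D := by
    intro x
    have hi : Isometry fun t : ℝ => (⟨x, t⟩ : ℂ) := Isometry.of_dist_eq fun s t => by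
      exact Complex.dist_of_re_eq rfl
    rw [hi.hausdorffMeasure_image (Or.inl zero_le_one), hausdorffMeasure_real, Real.volume_Icc]
    exact ENNReal.ofReal_le_ofReal hyD
  have hsub : frontier (Set.Icc x₀ x₁ ×ℂ Set.Icc y₀ y₁) ⊆
      (((fun t : ℝ => (⟨t, y₀⟩ : ℂ)) '' Set.Icc x₀ x₁) ∪
        ((fun t : ℝ => (⟨t, y₁⟩ : ℂ)) '' Set.Icc x₀ x₁)) ∪
      (((fun t : ℝ => (⟨x₀, t⟩ : ℂ)) '' Set.Icc y₀ y₁) ∪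
        ((fun t : ℝ => (⟨x₁, t⟩ : ℂ)) '' Set.Icc y₀ y₁)) := by
    rw [Complex.frontier_reProdIm, closure_Icc, closure_Icc, frontier_Icc hx, frontier_Icc hy]
    rintro z (⟨h1, h2⟩ | ⟨h1, h2⟩)
    · rcases h2 with h2 | h2
      · exact Or.inl (Or.inl ⟨z.re, h1, Complex.ext rfl h2.symm⟩)
      · exact Or.inl (Or.inr ⟨z.re, h1, Complex.ext rfl (Eq.symm h2)⟩)
    · rcases h1 with h1 | h1
      · exact Or.inr (Or.inl ⟨z.im, h2, Complex.ext h1.symm rfl⟩)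
      · exact Or.inr (Or.inr ⟨z.im, h2, Complex.ext (Eq.symm h1) rfl⟩)
  refine (measure_mono hsub).trans ((measure_union_le _ _).trans ?_)
  refine (add_le_add ((measure_union_le _ _).trans (add_le_add (hH _) (hH _)))
    ((measure_union_le _ _).trans (add_le_add (hV _) (hV _)))).trans_eq ?_
  ring

/-- The bounding box of `K` has four sides, each at most the diameter. -/
theorem hausdorffMeasure_frontier_le {K : Set ℂ} (hK : IsCompact K) (hconv : Convex ℝ K)
    (hint : (interior K).Nonempty) :
    Measure.hausdorffMeasure 1 (frontier K) ≤ 4 * ENNReal.ofReal (Metric.diam K) := by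
  have hne : K.Nonempty := hint.mono interior_subset
  obtain ⟨p, hp, hpm⟩ := hK.exists_isMinOn hne Complex.continuous_re.continuousOn
  obtain ⟨q, hq, hqm⟩ := hK.exists_isMaxOn hne Complex.continuous_re.continuousOn
  obtain ⟨r, hr, hrm⟩ := hK.exists_isMinOn hne Complex.continuous_im.continuousOn
  obtain ⟨s, hs, hsm⟩ := hK.exists_isMaxOn hne Complex.continuous_im.continuousOn
  refine (hausdorffMeasure_frontier_mono hK.isClosed hconv hint
    (isCompact_Icc.reProdIm isCompact_Icc) fun z hz => ⟨⟨hpm hz, hqm hz⟩, hrm hz, hsm hz⟩).trans ?_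
  refine hausdorffMeasure_frontier_rect_le (hpm hq) (hrm hs) ?_ ?_
  · have := Metric.dist_le_diam_of_mem hK.isBounded hq hp
    rw [dist_eq_norm] at this
    simpa using (Complex.re_le_norm _).trans this
  · have := Metric.dist_le_diam_of_mem hK.isBounded hs hr
    rw [dist_eq_norm] at this
    simpa using (Complex.im_le_norm _).trans this

/-! ### Lower bound for the boundary length over the middle strip -/

theorem exists_mem_frontier_ge {K : Set ℂ} (hK : IsCompact K) {a b : ℂ} (hab : a ≠ b) {z : ℂ}
    (hz : z ∈ K) : ∃ u ∈ frontier K, (coord a b u).re = (coord a b z).re ∧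
      (coord a b z).im ≤ (coord a b u).im := by
  have hc : IsCompact {u ∈ K | (coord a b u).re = (coord a b z).re} :=
    hK.inter_right (isClosed_eq (Complex.continuous_re.comp (continuous_coord a b))
      continuous_const)
  obtain ⟨u, hu, hmax⟩ := hc.exists_isMaxOn ⟨z, hz, rfl⟩
    (Complex.continuous_im.comp (continuous_coord a b)).continuousOn
  refine ⟨u, mem_frontier_of_forall_add_notMem (v := Complex.I * (b - a)) hu.1 fun t ht hmem => ?_,
    hu.2, hmax ⟨hz, rfl⟩⟩
  have e : coord a b (u + t * (Complex.I * (b - a))) = coord a b u + 2 * (t * Complex.I) := by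
    rw [← mul_assoc, coord_add_mul hab]
  have := hmax (a := u + t * (Complex.I * (b - a))) ⟨hmem, by rw [e, ← hu.2]; simp⟩
  simp only [Function.comp, Set.mem_ofPred_eq, e] at this
  simp at this
  linarith

theorem coord_swap (a b z : ℂ) : coord b a z = -coord a b z := by
  unfold coord
  rw [← neg_sub b a, div_neg]
  ring

theorem exists_mem_frontier_le {K : Set ℂ} (hK : IsCompact K) {a b : ℂ} (hab : a ≠ b) {z : ℂ}
    (hz : z ∈ K) : ∃ u ∈ frontier K, (coord a b u).re = (coord a b z).re ∧
      (coord a b u).im ≤ (coord a b z).im := by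
  obtain ⟨u, hu, h1, h2⟩ := exists_mem_frontier_ge hK hab.symm hz
  rw [coord_swap a b, coord_swap a b] at h1 h2
  exact ⟨u, hu, by simpa using h1, by simpa using h2⟩

namespace IsDiameter

variable {K : Set ℂ} {a b : ℂ}

theorem symm (h : IsDiameter K a b) : IsDiameter K b a :=
  ⟨h.right_mem, h.left_mem, by rw [dist_comm, h.dist_eq]⟩

/-- Sets meeting every line orthogonal to the middle part of the diameter are long. -/
theorem le_hausdorffMeasure (h : IsDiameter K a b) (hd : 0 < Metric.diam K) {δ : ℝ} {S : Set ℂ}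
    (hS : ∀ x : ℝ, |x| ≤ δ / 2 → ∃ u ∈ S, (coord a b u).re = x) :
    ENNReal.ofReal (δ * Metric.diam K / 2) ≤ Measure.hausdorffMeasure 1 S := by
  -- Projecting to the real coordinate expands lengths by at most `2 / d`, and the image of `S`
  -- covers an interval of length `δ`.
  have hlip : LipschitzWith (Real.toNNReal (2 / Metric.diam K)) fun z => (coord a b z).re := by
    refine LipschitzWith.of_dist_le_mul fun x y => ?_
    rw [Real.coe_toNNReal _ (by positivity), Real.dist_eq, ← Complex.sub_re]
    refine (Complex.abs_re_le_norm _).trans_eq ?_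
    rw [coord, coord, ← sub_div, norm_div, h.norm_sub, dist_eq_norm,
      show 2 * x - a - b - (2 * y - a - b) = 2 * (x - y) by ring, norm_mul, Complex.norm_two]
    ring
  have himg : Set.Icc (-(δ / 2)) (δ / 2) ⊆ (fun z => (coord a b z).re) '' S := by
    intro x hx
    obtain ⟨u, hu, hux⟩ := hS x (abs_le.2 hx)
    exact ⟨u, hu, hux⟩
  have h1 := (measure_mono himg).trans (hlip.hausdorffMeasure_image_le (d := 1) zero_le_one S)
  rw [hausdorffMeasure_real, Real.volume_Icc, ENNReal.rpow_one] at h1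
  have h2 : ENNReal.ofReal (δ * Metric.diam K / 2) =
      ENNReal.ofReal (Metric.diam K / 2) * ENNReal.ofReal (δ / 2 - -(δ / 2)) := by
    rw [← ENNReal.ofReal_mul (by positivity)]; congr 1; ring
  rw [h2]
  refine (mul_le_mul_right h1 _).trans_eq ?_
  rw [← mul_assoc]
  change ENNReal.ofReal (Metric.diam K / 2) * ENNReal.ofReal (2 / Metric.diam K) * _ = _
  rw [← ENNReal.ofReal_mul (by positivity), div_mul_div_comm, mul_comm 2, div_self (by positivity),
    ENNReal.ofReal_one, one_mul]

/-- The segments from `z₁` to the two ends of the diameter lie in `K`; one of them passes over `x`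
strictly above the axis. -/
theorem exists_coord_eq_of_im_pos (h : IsDiameter K a b) (hconv : Convex ℝ K) (hab : a ≠ b)
    {z₁ : ℂ} (hz₁ : z₁ ∈ K) (him : 0 < (coord a b z₁).im) {x : ℝ} (hx : |x| < 1) :
    ∃ z ∈ K, (coord a b z).re = x ∧ 0 < (coord a b z).im := by
  rw [abs_lt] at hx
  set x₁ := (coord a b z₁).re with hx₁
  by_cases hle : x ≤ x₁
  · set t := (x + 1) / (x₁ + 1) with ht
    have hp : 0 < x₁ + 1 := by linarith
    have ht0 : 0 < t := div_pos (by linarith) hp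
    have ht1 : t ≤ 1 := (div_le_one hp).2 (by linarith)
    refine ⟨(1 - t) • a + t • z₁, hconv h.left_mem hz₁ (by linarith) ht0.le (by ring), ?_, ?_⟩
    · rw [coord_combo _ _ _ _ (by ring), coord_left hab]
      simp only [Complex.add_re, Complex.re_ofReal_mul, ← hx₁]
      simp
      rw [ht]; field_simp; ring
    · rw [coord_combo _ _ _ _ (by ring), coord_left hab]
      simp only [Complex.add_im, Complex.im_ofReal_mul]
      simp
      positivity
  · push Not at hle
    set t := (1 - x) / (1 - x₁) with ht
    have hp : 0 < 1 - x₁ := by linarith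
    have ht0 : 0 < t := div_pos (by linarith) hp
    have ht1 : t ≤ 1 := (div_le_one hp).2 (by linarith)
    refine ⟨(1 - t) • b + t • z₁, hconv h.right_mem hz₁ (by linarith) ht0.le (by ring), ?_, ?_⟩
    · rw [coord_combo _ _ _ _ (by ring), coord_right hab]
      simp only [Complex.add_re, Complex.re_ofReal_mul, ← hx₁]
      simp
      rw [ht]; field_simp; ring
    · rw [coord_combo _ _ _ _ (by ring), coord_right hab]
      simp only [Complex.add_im, Complex.im_ofReal_mul]
      simp
      positivity

theorem exists_coord_eq (h : IsDiameter K a b) (hconv : Convex ℝ K) (hab : a ≠ b)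
    {x : ℝ} (hx : |x| ≤ 1) : ∃ z ∈ K, coord a b z = x := by
  rw [abs_le] at hx
  refine ⟨((1 - x) / 2) • a + ((1 + x) / 2) • b,
    hconv h.left_mem h.right_mem (by linarith) (by linarith) (by ring), ?_⟩
  rw [coord_combo _ _ _ _ (by ring), coord_left hab, coord_right hab]
  push_cast
  ring

/-- Over each `x` the topmost point of `K` has positive imaginary coordinate and the bottommost does
not, since the diameter lies in `K`. The two pieces of boundary are disjoint, each of length at
least `δ d / 2`. -/
theorem le_hausdorffMeasure_frontier_of_im_pos (h : IsDiameter K a b) (hK : IsCompact K)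
    (hconv : Convex ℝ K) (hd : 0 < Metric.diam K) {δ : ℝ} (hδ0 : 0 ≤ δ) (hδ1 : δ ≤ 1)
    {z₁ : ℂ} (hz₁ : z₁ ∈ K) (him : 0 < (coord a b z₁).im) :
    ENNReal.ofReal (δ * Metric.diam K) ≤
      Measure.hausdorffMeasure 1 (frontier K ∩ {z | |(coord a b z).re| ≤ δ / 2}) := by
  have hab := h.ne hd
  set S := frontier K ∩ {z | |(coord a b z).re| ≤ δ / 2} with hS
  have hmeas : MeasurableSet {z | 0 < (coord a b z).im} :=
    (isOpen_lt continuous_const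
      (Complex.continuous_im.comp (continuous_coord a b))).measurableSet
  have htop : ENNReal.ofReal (δ * Metric.diam K / 2) ≤
      Measure.hausdorffMeasure 1 (S ∩ {z | 0 < (coord a b z).im}) := by
    refine h.le_hausdorffMeasure hd fun x hx => ?_
    obtain ⟨z, hz, hzx, hzi⟩ := h.exists_coord_eq_of_im_pos hconv hab hz₁ him (x := x)
      (by linarith)
    obtain ⟨u, hu, hur, hui⟩ := exists_mem_frontier_ge hK hab hz
    refine ⟨u, ⟨⟨hu, ?_⟩, lt_of_lt_of_le hzi hui⟩, hur.trans hzx⟩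
    rw [Set.mem_ofPred_eq, hur, hzx]; exact hx
  have hbot : ENNReal.ofReal (δ * Metric.diam K / 2) ≤
      Measure.hausdorffMeasure 1 (S \ {z | 0 < (coord a b z).im}) := by
    refine h.le_hausdorffMeasure hd fun x hx => ?_
    obtain ⟨z, hz, hzx⟩ := h.exists_coord_eq hconv hab (x := x) (by linarith)
    obtain ⟨u, hu, hur, hui⟩ := exists_mem_frontier_le hK hab hz
    rw [hzx, Complex.ofReal_re] at hur
    rw [hzx, Complex.ofReal_im] at hui
    refine ⟨u, ⟨⟨hu, ?_⟩, not_lt.2 hui⟩, hur⟩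
    rw [Set.mem_ofPred_eq, hur]; exact hx
  rw [← measure_inter_add_sdiff S hmeas]
  refine le_trans (le_of_eq ?_) (add_le_add htop hbot)
  rw [← ENNReal.ofReal_add (by positivity) (by positivity)]
  congr 1; ring

theorem le_hausdorffMeasure_frontier (h : IsDiameter K a b) (hK : IsCompact K)
    (hconv : Convex ℝ K) (hd : 0 < Metric.diam K) (hw : 0 < width K) {δ : ℝ} (hδ0 : 0 ≤ δ)
    (hδ1 : δ ≤ 1) :
    ENNReal.ofReal (δ * Metric.diam K) ≤
      Measure.hausdorffMeasure 1 (frontier K ∩ {z | |(coord a b z).re| ≤ δ / 2}) := by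
  by_cases hpos : ∃ z ∈ K, 0 < (coord a b z).im
  · obtain ⟨z₁, hz₁, him⟩ := hpos
    exact h.le_hausdorffMeasure_frontier_of_im_pos hK hconv hd hδ0 hδ1 hz₁ him
  by_cases hneg : ∃ z ∈ K, (coord a b z).im < 0
  · obtain ⟨z₁, hz₁, him⟩ := hneg
    have := h.symm.le_hausdorffMeasure_frontier_of_im_pos hK hconv hd hδ0 hδ1 hz₁
      (by rw [coord_swap]; simpa using him)
    simpa only [coord_swap a b, Complex.neg_re, abs_neg] using this
  -- Here `K` lies on the line through `a` and `b`, so its width is zero.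
  exfalso
  push Not at hpos hneg
  have hba : b - a ≠ 0 := sub_ne_zero.2 (h.ne hd).symm
  refine hw.not_ge (width_nonpos_of_re_mul_eq hK (c := Complex.I / (b - a))
    (div_ne_zero Complex.I_ne_zero hba) ?_)
  have key : ∀ z ∈ K, (z * (Complex.I / (b - a))).re =
      (((a + b) / 2) * (Complex.I / (b - a))).re := by
    intro z hz
    have h0 : (coord a b z).im = 0 := le_antisymm (hpos z hz) (hneg z hz)
    have e : z * (Complex.I / (b - a)) =
        ((1 / 2 : ℝ) : ℂ) * (coord a b z * Complex.I) + (a + b) / 2 * (Complex.I / (b - a)) := by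
      rw [coord]; push_cast; field_simp; ring
    rw [e, Complex.add_re, Complex.re_ofReal_mul, Complex.mul_I_re, h0]
    simp
  intro z hz z' hz'
  rw [key z hz, key z' hz']

end IsDiameter

/-! ### The constant `C_q` -/

theorem five_rpow_mul_le_constC {q : ℝ} (hq : 0 < q) : 5 ^ (1 / q) * 121 ≤ constC q := by
  have hs : q ≤ √(q ^ 2 + 3 * q + 1) := Real.le_sqrt_of_sq_le (by linarith)
  have hs1 : 1 ≤ √(q ^ 2 + 3 * q + 1) := Real.le_sqrt_of_sq_le (by nlinarith)
  have h1 : 1 ≤ (3 * q + 2 + 2 * √(q ^ 2 + 3 * q + 1)) / (5 * q) := by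
    rw [le_div_iff₀ (by positivity)]; linarith
  have h2 : (5 : ℝ) ^ (1 / q) ≤ (3 + 2 * q + 2 * √(q ^ 2 + 3 * q + 1)) ^ (1 / q) :=
    Real.rpow_le_rpow (by norm_num) (by linarith) (by positivity)
  rw [constC, mul_comm]
  exact mul_le_mul (by linarith) h2 (by positivity) (by positivity)

theorem tendsto_constC : Filter.Tendsto constC Filter.atTop (nhds 121) := by
  have hinv : Filter.Tendsto (fun q : ℝ => q⁻¹) Filter.atTop (nhds 0) := tendsto_inv_atTop_zero
  have h1 : Filter.Tendsto
      (fun q : ℝ => (3 + 2 * q⁻¹ + 2 * √(1 + 3 * q⁻¹ + q⁻¹ * q⁻¹)) / 5) Filter.atTop (nhds 1) := by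
    have hc : Continuous fun t : ℝ => (3 + 2 * t + 2 * √(1 + 3 * t + t * t)) / 5 := by fun_prop
    have := (hc.tendsto 0).comp hinv
    norm_num at this
    exact this
  have h1' : Filter.Tendsto
      (fun q : ℝ => (3 * q + 2 + 2 * √(q ^ 2 + 3 * q + 1)) / (5 * q)) Filter.atTop (nhds 1) := by
    refine h1.congr' ?_
    filter_upwards [Filter.eventually_gt_atTop 0] with q hq
    have e : √(q ^ 2 + 3 * q + 1) = q * √(1 + 3 * q⁻¹ + q⁻¹ * q⁻¹) := by
      rw [show q ^ 2 + 3 * q + 1 = q ^ 2 * (1 + 3 * q⁻¹ + q⁻¹ * q⁻¹) by field_simp,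
        Real.sqrt_mul (sq_nonneg q), Real.sqrt_sq hq.le]
    rw [e]
    field_simp
  have h2 : Filter.Tendsto
      (fun q : ℝ => (3 + 2 * q + 2 * √(q ^ 2 + 3 * q + 1)) ^ (1 / q)) Filter.atTop (nhds 1) := by
    have hup : Filter.Tendsto (fun q : ℝ => q ^ (2 / q)) Filter.atTop (nhds 1) := by
      simpa using tendsto_rpow_div_mul_add 2 1 0 zero_ne_one
    -- The base is at least 1 and, for `q ≥ 10`, at most `4q + 7 ≤ q²`.
    refine tendsto_of_tendsto_of_tendsto_of_le_of_le' tendsto_const_nhds hup ?_ ?_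
    · filter_upwards [Filter.eventually_gt_atTop 0] with q hq
      refine Real.one_le_rpow ?_ (by positivity)
      linarith [Real.sqrt_nonneg (q ^ 2 + 3 * q + 1)]
    · filter_upwards [Filter.eventually_ge_atTop 10] with q hq
      rw [div_eq_mul_one_div 2 q, Real.rpow_mul (by linarith)]
      refine Real.rpow_le_rpow (by positivity) ?_ (by positivity)
      have : √(q ^ 2 + 3 * q + 1) ≤ q + 2 := by
        rw [Real.sqrt_le_left (by linarith)]; nlinarith
      rw [Real.rpow_two]
      nlinarith
  have h3 := (h1'.const_mul 121).mul h2
  simp only [mul_one] at h3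
  exact h3

/-! ### The test polynomial on `K` -/

/-- The `n`-th model polynomial, placed so that its zeros are `a` and `b`. -/
noncomputable def diameterPoly (a b : ℂ) (n : ℕ) : ℂ[X] :=
  (modelPoly n).comp (C (2 / (b - a)) * X + C (-(a + b) / (b - a)))

section DiameterPoly

variable {a b : ℂ}

theorem eval_diameterPoly (n : ℕ) (z : ℂ) :
    (diameterPoly a b n).eval z = (modelPoly n).eval (coord a b z) := by
  rw [diameterPoly, eval_comp]
  congr 1
  simp only [eval_add, eval_mul, eval_C, eval_X, coord]
  ring

theorem eval_derivative_diameterPoly (n : ℕ) (z : ℂ) :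
    (derivative (diameterPoly a b n)).eval z =
      2 / (b - a) * (derivative (modelPoly n)).eval (coord a b z) := by
  rw [diameterPoly, derivative_comp, eval_mul, eval_comp]
  congr 1
  · simp
  · congr 1
    simp only [eval_add, eval_mul, eval_C, eval_X, coord]
    ring

theorem diameterPoly_mem_polyClass {K : Set ℂ} (ha : a ∈ K) (hb : b ∈ K) (hab : a ≠ b) (n : ℕ) :
    diameterPoly a b n ∈ polyClass n K := by
  have hba : b - a ≠ 0 := sub_ne_zero.2 hab.symm
  have hnd : (diameterPoly a b n).natDegree = n := by
    rw [diameterPoly, natDegree_comp, natDegree_modelPoly,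
      natDegree_linear (div_ne_zero two_ne_zero hba), mul_one]
  have hne : diameterPoly a b n ≠ 0 := by
    intro h0
    have h1 : (modelPoly n).eval 0 = 0 := by
      have : coord a b ((a + b) / 2) = 0 := by unfold coord; field_simp; ring
      have h2 := eval_diameterPoly (a := a) (b := b) n ((a + b) / 2)
      rwa [h0, eval_zero, this, eq_comm] at h2
    simp [modelPoly] at h1
  refine ⟨by rw [degree_eq_natDegree hne, hnd], fun z hz => ?_⟩
  rw [IsRoot.def, eval_diameterPoly, modelPoly, eval_mul, eval_pow, eval_pow, mul_eq_zero] at hz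
  rcases hz with hz | hz
  · have h1 := eq_zero_of_pow_eq_zero hz
    rw [eval_sub, eval_X, eval_C, coord_sub_one hab] at h1
    rcases mul_eq_zero.1 h1 with h2 | h2
    · exact absurd h2 (div_ne_zero two_ne_zero hba)
    · rwa [sub_eq_zero.1 h2]
  · have h1 := eq_zero_of_pow_eq_zero hz
    rw [eval_add, eval_X, eval_C, coord_add_one hab] at h1
    rcases mul_eq_zero.1 h1 with h2 | h2
    · exact absurd h2 (div_ne_zero two_ne_zero hba)
    · rwa [sub_eq_zero.1 h2]

end DiameterPoly

theorem IsDiameter.norm_eval_derivative_diameterPoly {K : Set ℂ} {a b : ℂ} (h : IsDiameter K a b)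
    (hK : IsCompact K) (hw : 0 < width K) {α : ℝ} (hα : 0 ≤ α) {n : ℕ}
    (hn : 2 * (1 + α) * (Metric.diam K ^ 2 / width K ^ 2) *
      Real.log (Metric.diam K / width K) ≤ n) {z : ℂ} (hz : z ∈ K) :
    ‖(derivative (diameterPoly a b n)).eval z‖ ≤
      121 * (width K / Metric.diam K ^ 2) * n * ‖(diameterPoly a b n).eval z‖ ∨
    ‖(derivative (diameterPoly a b n)).eval z‖ ≤
      121 * (width K / Metric.diam K ^ 2) * n *
        ((width K / Metric.diam K) ^ α * stripBound n (width K / Metric.diam K)) := by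
  have hwd := width_le_diam hK
  have hd : 0 < Metric.diam K := hw.trans_le hwd
  have hδ0 : 0 < width K / Metric.diam K := div_pos hw hd
  have hδ1 : width K / Metric.diam K ≤ 1 := (div_le_one hd).2 hwd
  have hs := stripBound_pos n hδ0 hδ1
  have hn' : 2 * (1 + α) * (1 / (width K / Metric.diam K) ^ 2) *
      Real.log (1 / (width K / Metric.diam K)) ≤ n := by
    rwa [one_div_div, div_pow, one_div_div]
  -- The chain rule factor `2 / d` turns `60 δ` into `120 w / d²`.
  have key : ∀ A B : ℝ, 0 ≤ B → A ≤ 60 * (width K / Metric.diam K) * n * B →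
      2 / Metric.diam K * A ≤ 121 * (width K / Metric.diam K ^ 2) * n * B := by
    intro A B hB hAB
    calc 2 / Metric.diam K * A
        ≤ 2 / Metric.diam K * (60 * (width K / Metric.diam K) * n * B) := by gcongr
      _ = 120 * (width K / Metric.diam K ^ 2) * n * B := by field_simp; ring
      _ ≤ 121 * (width K / Metric.diam K ^ 2) * n * B := by gcongr; norm_num
  rw [eval_derivative_diameterPoly, eval_diameterPoly, norm_mul, norm_div, h.norm_sub,
    Complex.norm_two]
  exact (norm_eval_derivative_modelPoly hδ0 hδ1 hα hn' (h.norm_coord_sub_one_le hK hd hz)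
    (h.norm_coord_add_one_le hK hd hz) (h.abs_im_coord_le hK hd hz)).imp
    (key _ _ (norm_nonneg _)) (key _ _ (by positivity))

/-! ### From pointwise bounds to norms -/

theorem inverseMarkov_le {n : ℕ} {q : ℝ≥0∞} {K : Set ℂ} {μ : Measure ℂ} {p : ℂ[X]} {c : ℝ≥0∞}
    (hp : p ∈ polyClass n K) (h0 : polyNorm K μ q p ≠ 0)
    (h : polyNorm K μ q (derivative p) ≤ c * polyNorm K μ q p) : inverseMarkov n q K μ ≤ c :=
  by
  have hmem : polyNorm K μ q (derivative p) / polyNorm K μ q p ∈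
      {r : ℝ≥0∞ | ∃ p ∈ polyClass n K, polyNorm K μ q p ≠ 0 ∧
        r = polyNorm K μ q (derivative p) / polyNorm K μ q p} := ⟨p, hp, h0, rfl⟩
  exact (sInf_le hmem).trans (ENNReal.div_le_of_le_mul h)

theorem arcLength_restrict {K : Set ℂ} (hK : IsClosed K) :
    (arcLength K).restrict K = arcLength K := by
  rw [arcLength, Measure.restrict_restrict hK.measurableSet,
    Set.inter_eq_right.2 hK.frontier_subset]

theorem polyNorm_arcLength {K : Set ℂ} (hK : IsClosed K) (q : ℝ≥0∞) (p : ℂ[X]) :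
    polyNorm K (arcLength K) q p = eLpNorm (fun z => p.eval z) q (arcLength K) := by
  rw [polyNorm, arcLength_restrict hK]

theorem ae_arcLength_mem {K : Set ℂ} (hK : IsClosed K) : ∀ᵐ z ∂arcLength K, z ∈ K := by
  filter_upwards [ae_restrict_mem isClosed_frontier.measurableSet] with z hz
  exact hK.frontier_subset hz

theorem arcLength_univ_le {K : Set ℂ} (hK : IsCompact K) (hconv : Convex ℝ K)
    (hint : (interior K).Nonempty) :
    arcLength K Set.univ ≤ 4 * ENNReal.ofReal (Metric.diam K) := by
  rw [arcLength, Measure.restrict_apply_univ]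
  exact hausdorffMeasure_frontier_le hK hconv hint

/-- The comparison of `L^q` norms from a pointwise bound by either the function itself or a small
constant, when the function is large on a set of controlled measure. -/
theorem eLpNorm_le_five_rpow_mul {X : Type*} [MeasurableSpace X] {μ : Measure X} {f g : X → ℂ}
    (hf : Measurable f) {q : ℝ} (hq : 0 < q) {Λ δ m D : ℝ} (hΛ : 0 ≤ Λ) (hδ : 0 < δ) (hμ : μ Set.univ ≤ 4 * ENNReal.ofReal D)
    (hS : ENNReal.ofReal (δ * D) ≤ μ {x | m ≤ ‖f x‖})
    (hgf : ∀ᵐ x ∂μ, ‖g x‖ ≤ Λ * ‖f x‖ ∨ ‖g x‖ ≤ Λ * (δ ^ (1 / q) * m)) :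
    eLpNorm g (ENNReal.ofReal q) μ ≤
      ENNReal.ofReal (5 ^ (1 / q) * Λ) * eLpNorm f (ENNReal.ofReal q) μ := by
  have hq0 : ENNReal.ofReal q ≠ 0 := by simpa using hq
  rw [eLpNorm_eq_lintegral_rpow_enorm_toReal hq0 ENNReal.ofReal_ne_top,
    eLpNorm_eq_lintegral_rpow_enorm_toReal hq0 ENNReal.ofReal_ne_top, ENNReal.toReal_ofReal hq.le]
  set I := ∫⁻ x, ‖f x‖ₑ ^ q ∂μ with hI
  -- Chebyshev's inequality on the set where `‖f‖ ≥ m`.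
  have hlow : ENNReal.ofReal m ^ q * ENNReal.ofReal (δ * D) ≤ I := by
    have hmeas : AEMeasurable (fun x => ‖f x‖ₑ ^ q) μ := by fun_prop
    refine le_trans ?_ (mul_meas_ge_le_lintegral₀ hmeas (ENNReal.ofReal m ^ q))
    gcongr
    refine hS.trans (measure_mono fun x hx => ?_)
    rw [Set.mem_ofPred_eq, ← ofReal_norm]
    exact ENNReal.rpow_le_rpow (ENNReal.ofReal_le_ofReal hx) hq.le
  have hpt : ∀ᵐ x ∂μ, ‖g x‖ₑ ^ q ≤ ENNReal.ofReal Λ ^ q * ‖f x‖ₑ ^ q +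
      ENNReal.ofReal Λ ^ q * (ENNReal.ofReal δ * ENNReal.ofReal m ^ q) := by
    filter_upwards [hgf] with x hx
    rcases hx with hx | hx
    · refine le_trans ?_ le_self_add
      rw [← ENNReal.mul_rpow_of_nonneg _ _ hq.le, ← ofReal_norm, ← ofReal_norm,
        ← ENNReal.ofReal_mul hΛ]
      exact ENNReal.rpow_le_rpow (ENNReal.ofReal_le_ofReal hx) hq.le
    · refine le_trans ?_ le_add_self
      -- The exponent `1 / q` is chosen so that its `q`-th power is exactly `δ`, matching the share
      -- of length in `hlow`.
      have e : ENNReal.ofReal δ = ENNReal.ofReal (δ ^ (1 / q)) ^ q := by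
        rw [ENNReal.ofReal_rpow_of_nonneg (by positivity) hq.le, ← Real.rpow_mul hδ.le,
          one_div_mul_cancel hq.ne', Real.rpow_one]
      rw [e, ← ENNReal.mul_rpow_of_nonneg _ _ hq.le, ← ENNReal.mul_rpow_of_nonneg _ _ hq.le,
        ← ENNReal.ofReal_mul (by positivity), ← ENNReal.ofReal_mul hΛ, ← ofReal_norm]
      exact ENNReal.rpow_le_rpow (ENNReal.ofReal_le_ofReal hx) hq.le
  have hint : ∫⁻ x, ‖g x‖ₑ ^ q ∂μ ≤ 5 * ENNReal.ofReal Λ ^ q * I := by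
    calc ∫⁻ x, ‖g x‖ₑ ^ q ∂μ
        ≤ ∫⁻ x, (ENNReal.ofReal Λ ^ q * ‖f x‖ₑ ^ q +
            ENNReal.ofReal Λ ^ q * (ENNReal.ofReal δ * ENNReal.ofReal m ^ q)) ∂μ :=
          lintegral_mono_ae hpt
      _ = ENNReal.ofReal Λ ^ q * I +
            ENNReal.ofReal Λ ^ q * (ENNReal.ofReal δ * ENNReal.ofReal m ^ q) * μ Set.univ := by
          rw [lintegral_add_right _ measurable_const, lintegral_const,
            lintegral_const_mul _ (by fun_prop)]
      _ ≤ ENNReal.ofReal Λ ^ q * I +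
            ENNReal.ofReal Λ ^ q * (ENNReal.ofReal δ * ENNReal.ofReal m ^ q) *
              (4 * ENNReal.ofReal D) := by gcongr
      _ = ENNReal.ofReal Λ ^ q * I +
            4 * ENNReal.ofReal Λ ^ q * (ENNReal.ofReal m ^ q * ENNReal.ofReal (δ * D)) := by
          rw [ENNReal.ofReal_mul hδ.le]; ring
      _ ≤ ENNReal.ofReal Λ ^ q * I + 4 * ENNReal.ofReal Λ ^ q * I := by gcongr
      _ = 5 * ENNReal.ofReal Λ ^ q * I := by ring
  refine (ENNReal.rpow_le_rpow hint (by positivity)).trans_eq ?_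
  rw [ENNReal.mul_rpow_of_nonneg _ _ (by positivity), ENNReal.mul_rpow_of_nonneg _ _ (by positivity),
    ← ENNReal.rpow_mul, mul_one_div_cancel hq.ne', ENNReal.rpow_one,
    ENNReal.ofReal_mul (by positivity), ← ENNReal.ofReal_rpow_of_pos (by norm_num)]
  simp

/-- Positive measure of the set where `‖f‖ ≥ m` already puts `m` below the essential supremum, so no
factor `δ^α` is needed. -/
theorem eLpNorm_top_le_mul {X : Type*} [MeasurableSpace X] {μ : Measure X} {f g : X → ℂ}
    {Λ m : ℝ} (hΛ : 0 ≤ Λ) (hS : μ {x | m ≤ ‖f x‖} ≠ 0)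
    (hgf : ∀ᵐ x ∂μ, ‖g x‖ ≤ Λ * ‖f x‖ ∨ ‖g x‖ ≤ Λ * m) :
    eLpNorm g ∞ μ ≤ ENNReal.ofReal Λ * eLpNorm f ∞ μ := by
  simp only [eLpNorm_exponent_top]
  have hm : ENNReal.ofReal m ≤ eLpNormEssSup f μ := by
    by_contra! hlt
    refine hS (measure_mono_null (fun x hx => ?_) (ae_le_eLpNormEssSup (f := f) (μ := μ)))
    refine not_le.2 (hlt.trans_le ?_)
    rw [← ofReal_norm]
    exact ENNReal.ofReal_le_ofReal hx
  refine essSup_le_of_ae_le _ ?_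
  filter_upwards [hgf, ae_le_eLpNormEssSup (f := f) (μ := μ)] with x hx hfx
  rw [← ofReal_norm]
  rcases hx with hx | hx
  · refine (ENNReal.ofReal_le_ofReal hx).trans ?_
    rw [ENNReal.ofReal_mul hΛ, ofReal_norm]
    gcongr
  · refine (ENNReal.ofReal_le_ofReal hx).trans ?_
    rw [ENNReal.ofReal_mul hΛ]
    gcongr

theorem eLpNorm_ne_zero_of_measure_ne_zero {X : Type*} [MeasurableSpace X] {μ : Measure X}
    {f : X → ℂ} (hf : Measurable f) {q : ℝ≥0∞} (hq : q ≠ 0) {m : ℝ} (hm : 0 < m)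
    (hS : μ {x | m ≤ ‖f x‖} ≠ 0) : eLpNorm f q μ ≠ 0 := by
  intro h0
  rw [eLpNorm_eq_zero_iff hf.aestronglyMeasurable hq] at h0
  refine hS (measure_mono_null (fun x hx => ?_) h0)
  intro hx0
  have hx' : m ≤ ‖f x‖ := hx
  have hx0' : f x = 0 := hx0
  rw [hx0', norm_zero] at hx'
  linarith

end TuranErod

/-! ### Assembly -/

theorem corollary1 (K : Set ℂ) (hK : IsCompact K) (hconv : Convex ℝ K)
    (w d : ℝ) (hw : w = TuranErod.width K) (hd : d = Metric.diam K) (hwpos : 0 < w) :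
    (∀ q : ℝ, 0 < q → ∀ n : ℕ, 2 * (1 + 1 / q) * (d ^ 2 / w ^ 2) * Real.log (d / w) ≤ (n : ℝ) →
      TuranErod.inverseMarkov n (ENNReal.ofReal q) K (TuranErod.arcLength K)
        ≤ ENNReal.ofReal (TuranErod.constC q * (w / d ^ 2) * n)) ∧
    (∀ n : ℕ, 2 * (d ^ 2 / w ^ 2) * Real.log (d / w) ≤ (n : ℝ) →
      TuranErod.inverseMarkov n ∞ K (TuranErod.arcLength K)
        ≤ ENNReal.ofReal (121 * (w / d ^ 2) * n)) ∧
    Filter.Tendsto TuranErod.constC Filter.atTop (nhds 121) := by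
  open TuranErod in
  open TuranErod in
  subst hw hd
  have hwd := width_le_diam hK
  have hd : 0 < Metric.diam K := hwpos.trans_le hwd
  have hne : K.Nonempty := by
    rw [Set.nonempty_iff_ne_empty]
    rintro rfl
    simp at hd
  obtain ⟨a, b, hab⟩ := exists_isDiameter hK hne
  have hδ0 : 0 < width K / Metric.diam K := div_pos hwpos hd
  have hδ1 : width K / Metric.diam K ≤ 1 := (div_le_one hd).2 hwd
  have hint := interior_nonempty_of_width_pos hK hconv hne hwpos
  have hL := arcLength_univ_le hK hconv hint
  have hS : ∀ n : ℕ, ENNReal.ofReal (width K / Metric.diam K * Metric.diam K) ≤ arcLength K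
      {z | stripBound n (width K / Metric.diam K) ≤ ‖(diameterPoly a b n).eval z‖} := by
    intro n
    refine (hab.le_hausdorffMeasure_frontier hK hconv hd hwpos hδ0.le hδ1).trans ?_
    rw [arcLength, Measure.restrict_apply' isClosed_frontier.measurableSet, Set.inter_comm]
    refine measure_mono (Set.inter_subset_inter_left _ fun z hz => ?_)
    rw [Set.mem_ofPred_eq, eval_diameterPoly]
    exact stripBound_le_norm_eval n hδ0 hδ1 hz
  have hS0 : ∀ n : ℕ, arcLength K
      {z | stripBound n (width K / Metric.diam K) ≤ ‖(diameterPoly a b n).eval z‖} ≠ 0 :=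
    fun n => ((ENNReal.ofReal_pos.2 (mul_pos hδ0 hd)).trans_le (hS n)).ne'
  have hmeas : ∀ n : ℕ, Measurable fun z => (diameterPoly a b n).eval z :=
    fun n => (diameterPoly a b n).continuous.measurable
  have hcls := diameterPoly_mem_polyClass hab.left_mem hab.right_mem (hab.ne hd)
  have hΛ : ∀ n : ℕ, 0 ≤ 121 * (width K / Metric.diam K ^ 2) * n := fun n => by positivity
  refine ⟨fun q hq n hn => ?_, fun n hn => ?_, tendsto_constC⟩
  · have hq0 : ENNReal.ofReal q ≠ 0 := by simpa using hq
    have h1 : inverseMarkov n (ENNReal.ofReal q) K (arcLength K) ≤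
        ENNReal.ofReal (5 ^ (1 / q) * (121 * (width K / Metric.diam K ^ 2) * n)) := by
      refine inverseMarkov_le (hcls n) ?_ ?_
      · rw [polyNorm_arcLength hK.isClosed]
        exact eLpNorm_ne_zero_of_measure_ne_zero (hmeas n) hq0 (stripBound_pos n hδ0 hδ1) (hS0 n)
      · rw [polyNorm_arcLength hK.isClosed, polyNorm_arcLength hK.isClosed]
        refine eLpNorm_le_five_rpow_mul (hmeas n) hq (hΛ n) hδ0 hL (hS n) ?_
        filter_upwards [ae_arcLength_mem hK.isClosed] with z hz
        exact hab.norm_eval_derivative_diameterPoly hK hwpos (by positivity) hn hz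
    refine h1.trans (ENNReal.ofReal_le_ofReal ?_)
    rw [← mul_assoc, ← mul_assoc]
    gcongr
    exact five_rpow_mul_le_constC hq
  · refine inverseMarkov_le (hcls n) ?_ ?_
    · rw [polyNorm_arcLength hK.isClosed]
      exact eLpNorm_ne_zero_of_measure_ne_zero (hmeas n) ENNReal.top_ne_zero
        (stripBound_pos n hδ0 hδ1) (hS0 n)
    · rw [polyNorm_arcLength hK.isClosed, polyNorm_arcLength hK.isClosed]
      refine eLpNorm_top_le_mul (hΛ n) (hS0 n) ?_
      filter_upwards [ae_arcLength_mem hK.isClosed] with z hz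
      have := hab.norm_eval_derivative_diameterPoly hK hwpos le_rfl (n := n) (α := 0)
        (by simpa using hn) hz
      simpa only [Real.rpow_zero, one_mul] using this
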